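/- Let $A$ be a finite abelian group, let $A^\omega=\bigoplus_{k=0}^{\infty}A$ be the direct sum of countably many copies of $A$, and for integers $n\ge 0$ let $\Phi_n=\{(a_k)_{k\ge0}\in A^\omega: a_k=0\text{ for }k\ge n\}\cong A^n$. Let $S=(S^a)_{a\in A^\omega}$ and $T=(T^a)_{a\in A^\omega}$ be two commuting measure-preserving actions of $A^\omega$ on a probability space $(X,\mathcal F,\mu)$ with $(X,\mathcal F)$ standard Borel; that is, all $S^a,T^a:X\to X$ are measurable and preserve $\mu$, $S^0=T^0=\mathrm{id}$, and $S^aS^b=S^{a+b}$, $T^aT^b=T^{a+b}$, $S^aT^b=T^bS^a$ for all $a,b\in A^\omega$. For measurable $f,g:X\to\mathbb C$ put $$M_n(f,g)=\frac1{|\Phi_n|}\sum_{a\in\Phi_n}(f\circ S^a)(g\circ T^a),\qquad n\ge 0.$$ For every $2\le p<\infty$ there is a finite constant $C_p$, depending only on $p$, such that for all $A,X,\mu,S,T,f,g$ as above the following hold. (1) $$\sup_{m,\;0\le n_0<n_1<\dots<n_m}\ \sum_{j=1}^m\big\|M_{n_{j-1}}(f,g)-M_{n_j}(f,g)\big\|_{L^p(\mu)}^p\le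 C_p\,\|f\|_{L^{2p}(\mu)}^p\,\|g\|_{L^{2p}(\mu)}^p,$$ where the right-hand side may be $+\infty$ and $\infty\cdot 0=0$. (2) For every $\varepsilon>0$ the number of $\varepsilon$-jumps in $L^p$ of the sequence $(M_n(f,g))_{n\ge0}$, that is, the supremum in $\{0,1,2,\dots,\infty\}$ of the integers $m\ge 0$ for which there are indices $n_1<n_1'\le n_2<n_2'\le\dots\le n_m<n_m'$ with $\|M_{n_j}(f,g)-M_{n_j'}(f,g)\|_{L^p(\mu)}\ge\varepsilon$ for $j=1,\dots,m$, is at most $C_p\,\varepsilon^{-p}\,\|f\|_{L^{2p}(\mu)}^p\,\|g\|_{L^{2p}(\mu)}^p$. (3) If $f,g\in L^{2p}(\mu)$, then all $M_n(f,g)$ lie in $L^p(\mu)$ and the sequence $(M_n(f,g))_{n\ge0}$ converges in $L^p(\mu)$. -/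

import Mathlib

open MeasureTheory Filter Topology
open scoped ENNReal NNReal

noncomputable section

namespace DoubleAverages

/-- The group `A^ω`, the direct sum of countably many copies of `A`: finitely supported sequences
`a = (a_k)_{k ≥ 0}` in `A` with coordinatewise addition. -/
abbrev Omega (A : Type*) [AddCommGroup A] : Type _ := ℕ →₀ A

section Folner

variable (A : Type*) [AddCommGroup A]

/-- The subset `Φ_n = {a ∈ A^ω : a_k = 0 for all k ≥ n}` of `A^ω`. -/
def folnerSet (n : ℕ) : Set (Omega A) := {a | ∀ k, n ≤ k → a k = 0}

theorem folnerSet_finite [Finite A] (n : ℕ) : (folnerSet A n).Finite := by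
  refine Set.Finite.of_injOn (t := (Set.univ : Set (Fin n → A)))
    (f := fun (a : Omega A) (i : Fin n) => a i) (fun _ _ => Set.mem_univ _) ?_ Set.finite_univ
  intro a ha b hb hab
  ext k
  by_cases hk : k < n
  · exact congrFun hab ⟨k, hk⟩
  · rw [ha k (not_lt.mp hk), hb k (not_lt.mp hk)]

/-- `Φ_n` as a finite set, for a finite group `A`. -/
def folner [Finite A] (n : ℕ) : Finset (Omega A) := (folnerSet_finite A n).toFinset

end Folner

/-- `S = (S^a)` is a measure preserving action of `A^ω` on `(X, μ)`: all `S^a` are measurable and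
preserve `μ`, `S^0` is the identity, and `S^(a + b) = S^a S^b`. -/
structure IsMeasurePreservingAction {A X : Type*} [AddCommGroup A] [MeasurableSpace X]
    (μ : Measure X) (S : Omega A → X → X) : Prop where
  measurePreserving : ∀ a, MeasurePreserving (S a) μ μ
  map_zero : S 0 = id
  map_add : ∀ a b, S (a + b) = S a ∘ S b

/-- The double average `M_n(f, g) = |Φ_n|⁻¹ ∑_{a ∈ Φ_n} (f ∘ S^a) (g ∘ T^a)`. -/
def doubleAverage {A X : Type*} [AddCommGroup A] [Finite A] (S T : Omega A → X → X)
    (f g : X → ℂ) (n : ℕ) : X → ℂ :=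
  fun x => ((folner A n).card : ℂ)⁻¹ * ∑ a ∈ folner A n, f (S a x) * g (T a x)

/-- The supremum, over all `m` and all `n_0 < n_1 < ⋯ < n_m`, of
`∑_{j=1}^m ‖M_{n_{j-1}} - M_{n_j}‖_p ^ p`, for a sequence `M_0, M_1, …` of functions. -/
def normVariation {X : Type*} [MeasurableSpace X] (μ : Measure X) (p : ℝ) (M : ℕ → X → ℂ) :
    ℝ≥0∞ :=
  ⨆ (m : ℕ) (n : Fin (m + 1) → ℕ) (_ : StrictMono n),
    ∑ j : Fin m, eLpNorm (M (n j.castSucc) - M (n j.succ)) (ENNReal.ofReal p) μ ^ p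

/-- There are indices `n_1 < n'_1 ≤ n_2 < n'_2 ≤ ⋯ ≤ n_m < n'_m` such that
`‖M_{n_j} - M_{n'_j}‖_p ≥ ε` for every `j`. -/
def HasJumps {X : Type*} [MeasurableSpace X] (μ : Measure X) (p : ℝ) (M : ℕ → X → ℂ) (ε : ℝ)
    (m : ℕ) : Prop :=
  ∃ n n' : Fin m → ℕ, (∀ j, n j < n' j) ∧ (∀ i j, i < j → n' i ≤ n j) ∧
    ∀ j, ENNReal.ofReal ε ≤ eLpNorm (M (n j) - M (n' j)) (ENNReal.ofReal p) μ

/-- The number of `ε`-jumps in `L^p` of a sequence of functions: the largest `m` for which there are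
`m` successive jumps, and infinity if there is no largest one. -/
def numJumps {X : Type*} [MeasurableSpace X] (μ : Measure X) (p : ℝ) (M : ℕ → X → ℂ) (ε : ℝ) :
    ℕ∞ :=
  ⨆ (m : ℕ) (_ : HasJumps μ p M ε m), (m : ℕ∞)

end DoubleAverages

end

noncomputable section

namespace DoubleAverages

open Finset ComplexConjugate
open scoped BigOperators

/-! Since `Φ_n` is a subgroup of the finite group `V = Φ_N` for `n ≤ N`, sampling `f` and `g` along
an orbit turns the problem into a bound on `V × V` for `M_H(F, G)(x, y) = 𝔼_{a ∈ H} F(x + a, y) G(x,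
y + a)` with `H` increasing. As everything is a group, no boundary error arises.

For `p = 2`, write `‖M_H - M_K‖² = ‖M_H‖² - ‖M_K‖² - 2 Re ⟨M_H - M_K, M_K⟩` with `H ≤ K`. The norms
telescope. In the coordinate `s = x + y`, the inner product becomes an average over `b ∈ K` and a
sum over `s` of `⟨u, (P_H - P_K) v⟩`, where `P_H`, `P_K` are coset averages, `u` comes from `F`
alone and `v` from `G` alone (`sum_groupAverage_mul_conj`). These are nested orthogonal projections,
so it equals `⟨(P_H - P_K) u, (P_H - P_K) v⟩` and splits into square functions of `F` and of `G`.
Each of these is at most the drop of a box form from `(H, H)` to `(K, K)` (`diffForm_le`), which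
telescopes too.

This gives an `L⁴ × L⁴ → L²` bound for the whole sequence of differences. Interpolation with the
trivial `L^∞` bound covers `p ≥ 2`, integration over orbits transfers it to `X`, and homogeneity
turns the sum of norms into a product. Jump counting and convergence follow from the variation
bound. -/

theorem expect_univ_eq_of_forall {ι M : Type*} {_ : Fintype ι} [Nonempty ι] [AddCommMonoid M]
    [Module ℚ≥0 M] {f : ι → M} {c : M} (h : ∀ i, f i = c) : 𝔼 i, f i = c := by
  rw [Finset.expect_congr rfl fun i _ => h i, Fintype.expect_const]

/-! ### Coset averages and box forms on a finite abelian group -/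

section FiniteGroup

variable {V : Type*} [AddCommGroup V] [Fintype V]

open scoped Classical in
/-- The average of `f` over the coset `x + H`. -/
def cosetAvg (H : AddSubgroup V) (f : V → ℂ) (x : V) : ℂ := 𝔼 a : H, f (x + a)

theorem cosetAvg_bot (f : V → ℂ) : cosetAvg ⊥ f = f := by
  classical
  funext x
  refine expect_univ_eq_of_forall ?_
  rintro ⟨a, ha⟩
  obtain rfl := AddSubgroup.mem_bot.1 ha
  rw [add_zero]

theorem cosetAvg_sub_left (H : AddSubgroup V) (f : V → ℂ) (s : V) :
    cosetAvg H (fun x => f (s - x)) = fun x => cosetAvg H f (s - x) := by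
  classical
  funext x
  refine Fintype.expect_equiv (Equiv.neg H) _ _ fun a => ?_
  exact congrArg f (by rw [Equiv.neg_apply, NegMemClass.coe_neg]; abel)

theorem sum_mul_conj_cosetAvg (H : AddSubgroup V) (f g : V → ℂ) :
    ∑ x, f x * conj (cosetAvg H g x) = ∑ x, cosetAvg H f x * conj (g x) := by
  classical
  simp only [cosetAvg, map_expect (starRingEnd ℂ), mul_expect, expect_mul,
    ← expect_sum_comm]
  refine Fintype.expect_equiv (Equiv.neg H) _ _ fun a => ?_
  refine Fintype.sum_equiv (Equiv.addRight (a : V)) _ _ fun x => ?_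
  simp

theorem cosetAvg_add_mem {H : AddSubgroup V} (f : V → ℂ) (x : V) {a : V} (ha : a ∈ H) :
    cosetAvg H f (x + a) = cosetAvg H f x := by
  classical
  refine Fintype.expect_equiv (Equiv.addLeft (⟨a, ha⟩ : H)) _ _ fun b => ?_
  simp [add_assoc]

theorem cosetAvg_cosetAvg_of_le {H K : AddSubgroup V} (h : H ≤ K) (f : V → ℂ) :
    cosetAvg H (cosetAvg K f) = cosetAvg K f := by
  classical
  funext x
  exact expect_univ_eq_of_forall fun a => cosetAvg_add_mem f x (h a.2)

theorem sum_cosetAvg_mul_conj_cosetAvg {H K : AddSubgroup V} (h : H ≤ K) (f g : V → ℂ) :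
    ∑ x, cosetAvg H f x * conj (cosetAvg K g x) = ∑ x, f x * conj (cosetAvg K g x) := by
  rw [← sum_mul_conj_cosetAvg, cosetAvg_cosetAvg_of_le h]

theorem sum_cosetAvg_mul_conj_cosetAvg' {H K : AddSubgroup V} (h : H ≤ K) (f g : V → ℂ) :
    ∑ x, cosetAvg K f x * conj (cosetAvg H g x) = ∑ x, f x * conj (cosetAvg K g x) := by
  rw [sum_mul_conj_cosetAvg, cosetAvg_cosetAvg_of_le h, sum_mul_conj_cosetAvg]

/-- Polarised Pythagorean identity for nested averages. -/
theorem sum_diff_mul_conj_diff {H K : AddSubgroup V} (h : H ≤ K) (f g : V → ℂ) :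
    ∑ x, (cosetAvg H f x - cosetAvg K f x) * conj (cosetAvg H g x - cosetAvg K g x) =
      ∑ x, f x * conj (cosetAvg H g x) - ∑ x, f x * conj (cosetAvg K g x) := by
  simp only [map_sub, mul_sub, sub_mul, sum_sub_distrib]
  rw [sum_cosetAvg_mul_conj_cosetAvg le_rfl, sum_cosetAvg_mul_conj_cosetAvg h,
    sum_cosetAvg_mul_conj_cosetAvg' h, sum_cosetAvg_mul_conj_cosetAvg le_rfl]
  ring

theorem ofReal_sum_norm_sq {V : Type*} [Fintype V] (f : V → ℂ) :
    ((∑ x, ‖f x‖ ^ 2 : ℝ) : ℂ) = ∑ x, f x * conj (f x) := by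
  push_cast
  exact sum_congr rfl fun x _ => (Complex.mul_conj' _).symm

theorem ofReal_sum_norm_cosetAvg_sq (H : AddSubgroup V) (f : V → ℂ) :
    ((∑ x, ‖cosetAvg H f x‖ ^ 2 : ℝ) : ℂ) = ∑ x, f x * conj (cosetAvg H f x) := by
  rw [ofReal_sum_norm_sq, sum_cosetAvg_mul_conj_cosetAvg le_rfl]

theorem sum_norm_diff_sq {H K : AddSubgroup V} (h : H ≤ K) (f : V → ℂ) :
    ∑ x, ‖cosetAvg H f x - cosetAvg K f x‖ ^ 2 =
      ∑ x, ‖cosetAvg H f x‖ ^ 2 - ∑ x, ‖cosetAvg K f x‖ ^ 2 := by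
  rw [← Complex.ofReal_inj, Complex.ofReal_sub, ofReal_sum_norm_cosetAvg_sq,
    ofReal_sum_norm_cosetAvg_sq, ofReal_sum_norm_sq (fun x => cosetAvg H f x - cosetAvg K f x),
    sum_diff_mul_conj_diff h]

theorem sum_norm_cosetAvg_sq_le {H K : AddSubgroup V} (h : H ≤ K) (f : V → ℂ) :
    ∑ x, ‖cosetAvg K f x‖ ^ 2 ≤ ∑ x, ‖cosetAvg H f x‖ ^ 2 := by
  rw [← sub_nonneg, ← sum_norm_diff_sq h]
  positivity

/-- The product of `U (s, ·)` and the conjugate of `U (s + b, ·)`. -/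
def shiftProd (U : V → V → ℂ) (b s : V) (y : V) : ℂ := U s y * conj (U (s + b) y)

open scoped Classical in
/-- The box form of `U` with first differences in `K` and second differences in `H`. -/
def boxForm (H K : AddSubgroup V) (U : V → V → ℂ) : ℝ :=
  𝔼 b : K, ∑ s, ∑ y, ‖cosetAvg H (shiftProd U b s) y‖ ^ 2

theorem boxForm_nonneg (H K : AddSubgroup V) (U : V → V → ℂ) : 0 ≤ boxForm H K U := by
  classical
  exact expect_nonneg fun b _ => by positivity

open scoped Classical in
theorem ofReal_boxForm (H K : AddSubgroup V) (U : V → V → ℂ) :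
    (boxForm H K U : ℂ) = 𝔼 b : K, 𝔼 c : H, ∑ s, ∑ y,
      U s y * conj (U (s + b) y) * conj (U s (y + c)) * U (s + b) (y + c) := by
  have (b : K) (s : V) := ofReal_sum_norm_cosetAvg_sq H (shiftProd U b s)
  rw [boxForm, ← Complex.ofRealHom_eq_coe, map_expect Complex.ofRealHom]
  refine expect_congr rfl fun b _ => ?_
  rw [Complex.ofRealHom_eq_coe, Complex.ofReal_sum, sum_congr rfl fun s _ => this b s]
  simp only [cosetAvg, map_expect (starRingEnd ℂ), mul_expect, ← expect_sum_comm, shiftProd]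
  simp only [map_mul, Complex.conj_conj, mul_assoc]

/-- The expanded form runs over the four corners of a rectangle with sides `b ∈ K` and `c ∈ H`.
Exchanging the axes exchanges the two mixed corners, both of which are conjugated. -/
theorem boxForm_swap (H K : AddSubgroup V) (U : V → V → ℂ) :
    boxForm H K U = boxForm K H (fun x y => U y x) := by
  classical
  rw [← Complex.ofReal_inj, ofReal_boxForm, ofReal_boxForm, expect_comm]
  refine expect_congr rfl fun c _ => expect_congr rfl fun b _ => ?_
  rw [sum_comm]
  refine sum_congr rfl fun y _ => sum_congr rfl fun s _ => ?_
  ring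

theorem boxForm_anti_left {H H' : AddSubgroup V} (h : H ≤ H') (K : AddSubgroup V)
    (U : V → V → ℂ) : boxForm H' K U ≤ boxForm H K U := by
  classical
  exact expect_le_expect fun b _ => sum_le_sum fun s _ => sum_norm_cosetAvg_sq_le h _

/-- Monotonicity in `H` is contraction of projections; the symmetry of the box form carries it to
`K`, where it is not visible from the definition. -/
theorem boxForm_anti_right (H : AddSubgroup V) {K K' : AddSubgroup V} (h : K ≤ K')
    (U : V → V → ℂ) : boxForm H K' U ≤ boxForm H K U := by
  rw [boxForm_swap H, boxForm_swap H]
  exact boxForm_anti_left h _ _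

theorem boxForm_bot (U : V → V → ℂ) : boxForm ⊥ ⊥ U = ∑ s, ∑ y, ‖U s y‖ ^ 4 := by
  classical
  refine expect_univ_eq_of_forall ?_
  rintro ⟨b, hb⟩
  refine sum_congr rfl fun s _ => sum_congr rfl fun y _ => ?_
  obtain rfl := AddSubgroup.mem_bot.1 hb
  rw [cosetAvg_bot, shiftProd, add_zero, norm_mul, Complex.norm_conj]
  ring

theorem boxForm_le (H K : AddSubgroup V) (U : V → V → ℂ) :
    boxForm H K U ≤ ∑ s, ∑ y, ‖U s y‖ ^ 4 :=
  boxForm_bot U ▸ (boxForm_anti_left bot_le K U).trans (boxForm_anti_right ⊥ bot_le U)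

open scoped Classical in
/-- The square function attached to two nested subgroups. -/
def diffForm (H K : AddSubgroup V) (U : V → V → ℂ) : ℝ :=
  𝔼 b : K, ∑ s, ∑ y, ‖cosetAvg H (shiftProd U b s) y - cosetAvg K (shiftProd U b s) y‖ ^ 2

/-- By Pythagoras the left side is exactly `boxForm H K U - boxForm K K U`. Shrinking the second
subgroup to `H` only increases the first term, and makes the bound telescope along a chain. -/
theorem diffForm_le {H K : AddSubgroup V} (h : H ≤ K) (U : V → V → ℂ) :
    diffForm H K U ≤ boxForm H H U - boxForm K K U := by
  classical
  refine le_trans (le_of_eq ?_) (sub_le_sub_right (boxForm_anti_right H h U) _)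
  rw [diffForm, boxForm, boxForm, ← expect_sub_distrib]
  refine expect_congr rfl fun b _ => ?_
  rw [← sum_sub_distrib]
  exact sum_congr rfl fun s _ => sum_norm_diff_sq h _

theorem sum_diffForm_le {H : ℕ → AddSubgroup V} (hH : Monotone H) (U : V → V → ℂ) (m : ℕ) :
    ∑ j ∈ range m, diffForm (H j) (H (j + 1)) U ≤ ∑ s, ∑ y, ‖U s y‖ ^ 4 := by
  calc _ ≤ ∑ j ∈ range m, (boxForm (H j) (H j) U - boxForm (H (j + 1)) (H (j + 1)) U) :=
        sum_le_sum fun j _ => diffForm_le (hH j.le_succ) U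
    _ = boxForm (H 0) (H 0) U - boxForm (H m) (H m) U :=
        sum_range_sub' (fun j => boxForm (H j) (H j) U) m
    _ ≤ _ := by linarith [boxForm_nonneg (H m) (H m) U, boxForm_le (H 0) (H 0) U]

/-! ### Energy estimate for double averages on `V × V` -/

/-- The points `(x + a, y)` and `(x, y + a)` have the same coordinate sum, so that sum is the
natural parameter for double averages. -/
theorem sum_sub_fst {M : Type*} [AddCommMonoid M] (f : V × V → M) :
    ∑ s, ∑ y, f (s - y, y) = ∑ z, f z := by
  rw [Fintype.sum_prod_type_right, sum_comm]
  exact sum_congr rfl fun y _ => Fintype.sum_equiv (Equiv.subRight y) _ _ fun s => rfl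

theorem sum_sub_snd {M : Type*} [AddCommMonoid M] (f : V × V → M) :
    ∑ s, ∑ x, f (x, s - x) = ∑ z, f z := by
  rw [Fintype.sum_prod_type, sum_comm]
  exact sum_congr rfl fun x _ => Fintype.sum_equiv (Equiv.subRight x) _ _ fun s => rfl

open scoped Classical in
/-- The double average over a subgroup `H` of functions on `V × V`. -/
def groupAverage (H : AddSubgroup V) (F G : V × V → ℂ) (z : V × V) : ℂ :=
  𝔼 a : H, F (z.1 + a, z.2) * G (z.1, z.2 + a)

theorem cosetAvg_conj (H : AddSubgroup V) (f : V → ℂ) (x : V) :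
    cosetAvg H (fun y => conj (f y)) x = conj (cosetAvg H f x) := by
  classical
  exact (map_expect (starRingEnd ℂ) _ _).symm

open scoped Classical in
theorem sum_groupAverage_mul_conj {H K : AddSubgroup V} (h : H ≤ K) (F G : V × V → ℂ) :
    ∑ z, groupAverage H F G z * conj (groupAverage K F G z) =
      𝔼 b : K, ∑ s, ∑ y, shiftProd (fun s y => F (s - y, y)) b s y *
        conj (cosetAvg H (fun y => conj (shiftProd (fun s x => G (x, s - x)) b s (s - y))) y) := by
  -- `K` absorbs the translation by `a ∈ H`, so that `b` becomes the displacement between the two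
  -- factors of the inner product.
  have shift (a : H) (z : V × V) : conj (groupAverage K F G z) =
      𝔼 b : K, conj (F (z.1 + (a + b), z.2) * G (z.1, z.2 + (a + b))) := by
    rw [groupAverage, map_expect (starRingEnd ℂ)]
    refine (Fintype.expect_equiv (Equiv.addLeft (⟨a, h a.2⟩ : K)) _ _ fun b => ?_).symm
    simp
  have expand (z : V × V) : groupAverage H F G z * conj (groupAverage K F G z) =
      𝔼 a : H, 𝔼 b : K, F (z.1 + a, z.2) * G (z.1, z.2 + a) *
        conj (F (z.1 + (a + b), z.2) * G (z.1, z.2 + (a + b))) := by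
    rw [groupAverage, expect_mul]
    exact expect_congr rfl fun a _ => by rw [shift a, mul_expect]
  simp only [expand, cosetAvg_conj, Complex.conj_conj]
  rw [← expect_sum_comm]
  simp only [← expect_sum_comm]
  rw [expect_comm]
  refine expect_congr rfl fun b _ => ?_
  simp only [cosetAvg_sub_left]
  simp only [cosetAvg, mul_expect, ← expect_sum_comm]
  refine Fintype.expect_equiv (Equiv.neg H) _ _ fun a => ?_
  rw [← sum_sub_fst]
  -- After this translation, `s` is the coordinate sum `x + a + y`. The `F` factors then no longer
  -- involve `a`, and the `G` factors average over `a`.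
  refine Fintype.sum_equiv (Equiv.addRight (a : V)) _ _ fun s => sum_congr rfl fun y _ => ?_
  have h1 : s - y + (a : V) = s + a - y := by abel
  have h2 : s - y + ((a : V) + b) = s + a + b - y := by abel
  have h3 : s + (a : V) - y + -a = s - y := by abel
  have h4 : s + (a : V) - (s - y) = y + a := by abel
  have h5 : s + (a : V) + b - (s - y) = y + (a + b) := by abel
  simp only [Equiv.coe_addRight, Equiv.neg_apply, NegMemClass.coe_neg, shiftProd, h1, h2, h3, h4,
    h5, map_mul]
  ring

theorem sum_groupAverage_sub_mul_conj_le {H K : AddSubgroup V} (h : H ≤ K) (F G : V × V → ℂ) :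
    ‖∑ z, (groupAverage H F G z - groupAverage K F G z) * conj (groupAverage K F G z)‖ ≤
      (diffForm H K (fun s y => F (s - y, y)) + diffForm H K (fun s x => G (x, s - x))) / 2 := by
  classical
  simp only [sub_mul, sum_sub_distrib]
  rw [sum_groupAverage_mul_conj h, sum_groupAverage_mul_conj le_rfl, ← expect_sub_distrib,
    diffForm, diffForm, ← expect_add_distrib, expect_div]
  refine (RCLike.norm_expect_le (K := ℂ)).trans (expect_le_expect fun b _ => ?_)
  rw [← sum_sub_distrib, ← sum_add_distrib, sum_div]
  refine (norm_sum_le _ _).trans (sum_le_sum fun s _ => ?_)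
  -- Both inner products average over `b ∈ K` and differ only in the inner projection. The polarised
  -- identity puts the difference of projections on both factors, ready for `2xy ≤ x² + y²`.
  rw [← sum_diff_mul_conj_diff h]
  set U : V → V → ℂ := fun s x => G (x, s - x)
  -- Reflection `y ↦ s - y` and conjugation commute with coset averages, so the `G` side is again a
  -- square function of the original form.
  have flip : ∑ y, ‖cosetAvg H (shiftProd U b s) y - cosetAvg K (shiftProd U b s) y‖ ^ 2 =
      ∑ y, ‖cosetAvg H (fun y => conj (shiftProd U b s (s - y))) y -
        cosetAvg K (fun y => conj (shiftProd U b s (s - y))) y‖ ^ 2 := by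
    refine Fintype.sum_equiv (Equiv.subLeft s) _ _ fun y => ?_
    simp only [cosetAvg_conj, cosetAvg_sub_left]
    rw [← map_sub, Complex.norm_conj, Equiv.subLeft_apply, sub_sub_cancel]
  rw [flip, ← sum_add_distrib, sum_div]
  refine (norm_sum_le _ _).trans (sum_le_sum fun y _ => ?_)
  rw [norm_mul, Complex.norm_conj]
  linarith [two_mul_le_add_sq ‖cosetAvg H (shiftProd (fun s y => F (s - y, y)) b s) y -
    cosetAvg K (shiftProd (fun s y => F (s - y, y)) b s) y‖
    ‖cosetAvg H (fun y => conj (shiftProd U b s (s - y))) y -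
        cosetAvg K (fun y => conj (shiftProd U b s (s - y))) y‖]

theorem norm_groupAverage_sq_le (H : AddSubgroup V) (F G : V × V → ℂ) :
    ∑ z, ‖groupAverage H F G z‖ ^ 2 ≤ (∑ z, ‖F z‖ ^ 4 + ∑ z, ‖G z‖ ^ 4) / 2 := by
  classical
  have pointwise (z : V × V) : ‖groupAverage H F G z‖ ^ 2 ≤
      𝔼 a : H, (‖F (z.1 + a, z.2)‖ ^ 4 + ‖G (z.1, z.2 + a)‖ ^ 4) / 2 := by
    have h1 : ‖groupAverage H F G z‖ ≤ 𝔼 a : H, ‖F (z.1 + a, z.2) * G (z.1, z.2 + a)‖ :=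
      RCLike.norm_expect_le (K := ℂ)
    have h2 := expect_mul_sq_le_sq_mul_sq univ
      (fun a : H => ‖F (z.1 + a, z.2) * G (z.1, z.2 + a)‖) fun _ => 1
    simp only [mul_one, one_pow, Fintype.expect_const] at h2
    refine ((pow_le_pow_left₀ (norm_nonneg _) h1 2).trans h2).trans
      (expect_le_expect fun a _ => ?_)
    rw [norm_mul]
    nlinarith [sq_nonneg (‖F (z.1 + a, z.2)‖ ^ 2 - ‖G (z.1, z.2 + a)‖ ^ 2)]
  refine (sum_le_sum fun z _ => pointwise z).trans (le_of_eq ?_)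
  rw [← expect_sum_comm]
  refine expect_univ_eq_of_forall fun a => ?_
  rw [← sum_div, sum_add_distrib]
  congr 2
  · exact Fintype.sum_equiv ((Equiv.addRight (a : V)).prodCongr (Equiv.refl V)) _ _ fun z => rfl
  · exact Fintype.sum_equiv ((Equiv.refl V).prodCongr (Equiv.addRight (a : V))) _ _ fun z => rfl

theorem sum_norm_groupAverage_sub_sq_le {H : ℕ → AddSubgroup V} (hH : Monotone H)
    (F G : V × V → ℂ) (m : ℕ) :
    ∑ j ∈ range m, ∑ z, ‖groupAverage (H j) F G z - groupAverage (H (j + 1)) F G z‖ ^ 2 ≤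
      3 / 2 * (∑ z, ‖F z‖ ^ 4 + ∑ z, ‖G z‖ ^ 4) := by
  set M := fun j => groupAverage (H j) F G
  have key (j : ℕ) : ∑ z, ‖M j z - M (j + 1) z‖ ^ 2 ≤
      ∑ z, ‖M j z‖ ^ 2 - ∑ z, ‖M (j + 1) z‖ ^ 2 +
      (diffForm (H j) (H (j + 1)) (fun s y => F (s - y, y)) +
        diffForm (H j) (H (j + 1)) (fun s x => G (x, s - x))) := by
    have expand : ∑ z, ‖M j z - M (j + 1) z‖ ^ 2 =
        ∑ z, ‖M j z‖ ^ 2 - ∑ z, ‖M (j + 1) z‖ ^ 2 -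
          2 * (∑ z, (M j z - M (j + 1) z) * conj (M (j + 1) z)).re := by
      rw [Complex.re_sum, mul_sum, ← sum_sub_distrib, ← sum_sub_distrib]
      refine sum_congr rfl fun z _ => ?_
      simp only [Complex.sq_norm, Complex.normSq_apply, Complex.sub_re, Complex.sub_im,
        Complex.mul_re, Complex.conj_re, Complex.conj_im]
      ring
    have := sum_groupAverage_sub_mul_conj_le (hH j.le_succ) F G
    have := (abs_le.1 ((Complex.abs_re_le_norm _).trans this)).1
    rw [expand]
    linarith
  have first := norm_groupAverage_sq_le (H 0) F G
  have second := sum_diffForm_le hH (fun s y => F (s - y, y)) m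
  have third := sum_diffForm_le hH (fun s x => G (x, s - x)) m
  have eF : ∑ s, ∑ y, ‖F (s - y, y)‖ ^ 4 = ∑ z, ‖F z‖ ^ 4 := sum_sub_fst fun z => ‖F z‖ ^ 4
  have eG : ∑ s, ∑ x, ‖G (x, s - x)‖ ^ 4 = ∑ z, ‖G z‖ ^ 4 := sum_sub_snd fun z => ‖G z‖ ^ 4
  calc _ ≤ ∑ j ∈ range m, (∑ z, ‖M j z‖ ^ 2 - ∑ z, ‖M (j + 1) z‖ ^ 2 +
      (diffForm (H j) (H (j + 1)) (fun s y => F (s - y, y)) +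
        diffForm (H j) (H (j + 1)) (fun s x => G (x, s - x)))) := sum_le_sum fun j _ => key j
    _ = ∑ z, ‖M 0 z‖ ^ 2 - ∑ z, ‖M m z‖ ^ 2 + _ := by
      rw [sum_add_distrib, sum_range_sub' (fun j => ∑ z, ‖M j z‖ ^ 2), sum_add_distrib]
    -- The constant `3 / 2` is `1 / 2` from `‖M 0‖²` plus `1` from the telescoped square functions.
    _ ≤ _ := by
      have : 0 ≤ ∑ z, ‖M m z‖ ^ 2 := by positivity
      rw [← eF, ← eG] at first ⊢
      linarith

end FiniteGroup

/-! ### Bilinear interpolation by the three lines theorem -/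

section Interpolation

/-- The entire function of `z` with value `w |w| ^ (q + r z - 1)` for `w ≠ 0` and zero for
`w = 0`. -/
def twist (q r : ℝ) (w z : ℂ) : ℂ :=
  if w = 0 then 0 else w / ‖w‖ * Complex.exp ((q + r * z) * Real.log ‖w‖)

theorem twist_zero (q r : ℝ) (z : ℂ) : twist q r 0 z = 0 := if_pos rfl

theorem norm_twist {q r : ℝ} {w : ℂ} (hw : w ≠ 0) (z : ℂ) :
    ‖twist q r w z‖ = ‖w‖ ^ (q + r * z.re) := by
  have hw' : 0 < ‖w‖ := norm_pos_iff.2 hw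
  rw [twist, if_neg hw, norm_mul, norm_div, Complex.norm_real, norm_norm, div_self hw'.ne', one_mul,
    Complex.norm_exp, Real.rpow_def_of_pos hw', Complex.re_mul_ofReal, Complex.add_re,
    Complex.ofReal_re, Complex.re_ofReal_mul, mul_comm]

theorem norm_twist_of_ne_zero {q r : ℝ} (w : ℂ) {z : ℂ} (h : q + r * z.re ≠ 0) :
    ‖twist q r w z‖ = ‖w‖ ^ (q + r * z.re) := by
  by_cases hw : w = 0
  · rw [hw, twist_zero, norm_zero, Real.zero_rpow h]
  · exact norm_twist hw z

theorem differentiable_twist (q r : ℝ) (w : ℂ) : Differentiable ℂ (twist q r w) := by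
  by_cases hw : w = 0
  · simp [funext (twist_zero q r), hw]
  · have : twist q r w = fun z => w / ‖w‖ * Complex.exp ((q + r * z) * Real.log ‖w‖) :=
      funext fun z => if_neg hw
    rw [this]
    fun_prop

theorem twist_of_add_eq {q r t : ℝ} (w : ℂ) {x : ℝ} (h : q + r * x = t) (hw : w ≠ 0) :
    twist q r w x = w / ‖w‖ * (‖w‖ ^ t : ℝ) := by
  rw [twist, if_neg hw, Real.rpow_def_of_pos (norm_pos_iff.2 hw), ← h]
  push_cast
  rw [mul_comm (Complex.ofReal _) (_ + _)]

open Complex.HadamardThreeLines Asymptotics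

theorem twist_isBigO (q r : ℝ) (w : ℂ) :
    twist q r w =O[𝓟 (verticalClosedStrip 0 1)] fun _ => (1 : ℝ) := by
  by_cases hw : w = 0
  · rw [hw, funext (twist_zero q r)]
    exact isBigO_zero (E' := ℂ) _ _
  · have hw' : ‖w‖ ≠ 0 := norm_ne_zero_iff.2 hw
    obtain ⟨B, hB⟩ := isCompact_Icc.exists_bound_of_continuousOn (s := Set.Icc (0 : ℝ) 1)
      (f := fun x => ‖w‖ ^ (q + r * x))
      (Continuous.continuousOn (.rpow continuous_const (by fun_prop) fun _ => .inl hw'))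
    refine isBigO_principal.2 ⟨B, fun z hz => ?_⟩
    rw [norm_twist hw, norm_one, mul_one]
    exact (Real.le_norm_self _).trans (hB z.re hz)

variable {ι κ Ω : Type*} [Fintype ι] [Fintype κ] [Fintype Ω]

/-- Bilinear interpolation between a bound `L⁴ × L⁴ → L²` and a bound `L^∞ × L^∞ → L^∞`, for
finite counting measures. -/
theorem sum_norm_rpow_le_of_interpolation (D : (ι → ℂ) →ₗ[ℂ] (κ → ℂ) →ₗ[ℂ] (Ω → ℂ))
    {B C p : ℝ} (hB : 0 ≤ B) (hC : 0 ≤ C) (hp : 2 ≤ p)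
    (bound : ∀ F G, (∀ i, ‖F i‖ ≤ 1) → (∀ k, ‖G k‖ ≤ 1) → ∀ ω, ‖D F G ω‖ ≤ B)
    (bound_two : ∀ F G, ∑ ω, ‖D F G ω‖ ^ 2 ≤ C * (∑ i, ‖F i‖ ^ 4 + ∑ k, ‖G k‖ ^ 4))
    (F : ι → ℂ) (G : κ → ℂ) :
    ∑ ω, ‖D F G ω‖ ^ p ≤
      B ^ (p - 2) * C * (∑ i, ‖F i‖ ^ (2 * p) + ∑ k, ‖G k‖ ^ (2 * p)) := by
  have hp0 : 0 < p := by linarith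
  set X := ∑ i, ‖F i‖ ^ (2 * p) + ∑ k, ‖G k‖ ^ (2 * p) with hX
  set Y := ∑ ω, ‖D F G ω‖ ^ p with hY
  have hX0 : 0 ≤ X := by positivity
  have hY0 : 0 ≤ Y := by positivity
  -- The moduli of `Fz` and `Gz` have exponent `0` on `re z = 0`, `p / 2` on `re z = 1`, and `1` at
  -- `z = 2 / p`. The dual function `h` has exponents `p`, `p / 2` and `p - 1` there, so `Φ (2 / p)
  -- = Y`.
  let Fz : ℂ → ι → ℂ := fun z i => twist 0 (p / 2) (F i) z
  let Gz : ℂ → κ → ℂ := fun z k => twist 0 (p / 2) (G k) z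
  let h : ℂ → Ω → ℂ := fun z ω => twist p (-(p / 2)) (conj (D F G ω)) z
  let Φ : ℂ → ℂ := fun z => ∑ ω, D (Fz z) (Gz z) ω * h z ω
  have hbil : IsBoundedBilinearMap ℂ fun x : (ι → ℂ) × (κ → ℂ) => D x.1 x.2 :=
    D.toContinuousBilinearMap.isBoundedBilinearMap
  have hFd : Differentiable ℂ Fz := differentiable_pi.2 fun i => differentiable_twist _ _ _
  have hGd : Differentiable ℂ Gz := differentiable_pi.2 fun i => differentiable_twist _ _ _
  have hDd : Differentiable ℂ fun z => D (Fz z) (Gz z) := fun z =>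
    DifferentiableAt.comp z (f := fun z => (Fz z, Gz z)) (hbil.differentiableAt (Fz z, Gz z))
      ((hFd z).prodMk (hGd z))
  have hΦd : Differentiable ℂ Φ := Differentiable.fun_sum fun ω _ =>
    (differentiable_pi.1 hDd ω).mul (differentiable_twist _ _ _)
  have hFO : Fz =O[𝓟 (verticalClosedStrip 0 1)] fun _ => (1 : ℝ) :=
    isBigO_pi.2 fun i => twist_isBigO _ _ _
  have hGO : Gz =O[𝓟 (verticalClosedStrip 0 1)] fun _ => (1 : ℝ) :=
    isBigO_pi.2 fun i => twist_isBigO _ _ _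
  have hDO : (fun z => D (Fz z) (Gz z)) =O[𝓟 (verticalClosedStrip 0 1)] fun _ => (1 : ℝ) := by
    have := hFO.norm_left.mul hGO.norm_left
    rw [mul_one] at this
    exact hbil.isBigO_comp.trans this
  have hΦO : Φ =O[𝓟 (verticalClosedStrip 0 1)] fun _ => (1 : ℝ) :=
    IsBigO.fun_sum fun ω _ => by
      simpa using (isBigO_pi.1 hDO ω).mul (twist_isBigO p (-(p / 2)) (conj (D F G ω)))
  have hΦB : BddAbove ((norm ∘ Φ) '' verticalClosedStrip 0 1) := by
    obtain ⟨c, hc⟩ := isBigO_principal.1 hΦO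
    refine ⟨c, ?_⟩
    rintro _ ⟨z, hz, rfl⟩
    simpa using hc z hz
  have left : ∀ z ∈ Complex.re ⁻¹' {0}, ‖Φ z‖ ≤ B * Y := by
    intro z hz
    have hz : z.re = 0 := hz
    -- Only an inequality: the exponent is `0` here, while the twist of `w = 0` is `0` rather than
    -- `1`.
    have le_one (w : ℂ) : ‖twist 0 (p / 2) w z‖ ≤ 1 := by
      by_cases hw : w = 0
      · simp [hw, twist_zero]
      · simp [norm_twist hw, hz]
    rw [hY, mul_sum]
    refine (norm_sum_le _ _).trans (sum_le_sum fun ω _ => ?_)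
    rw [norm_mul]
    refine mul_le_mul (bound _ _ (fun i => le_one _) (fun k => le_one _) ω) (le_of_eq ?_)
      (norm_nonneg _) hB
    have e : p + -(p / 2) * z.re = p := by rw [hz]; ring
    rw [norm_twist_of_ne_zero _ (by rw [e]; exact hp0.ne'), e, Complex.norm_conj]
  have right : ∀ z ∈ Complex.re ⁻¹' {1}, ‖Φ z‖ ≤ √(C * X) * √Y := by
    intro z hz
    have hz : z.re = 1 := hz
    have pow_four (w : ℂ) : ‖twist 0 (p / 2) w z‖ ^ 4 = ‖w‖ ^ (2 * p) := by
      have e : 0 + p / 2 * z.re = p / 2 := by rw [hz]; ring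
      rw [norm_twist_of_ne_zero _ (by rw [e]; positivity), e, ← Real.rpow_natCast,
        ← Real.rpow_mul (norm_nonneg _)]
      congr 1
      push_cast
      ring
    have hsq (ω : Ω) : ‖h z ω‖ ^ 2 = ‖D F G ω‖ ^ p := by
      have e : p + -(p / 2) * z.re = p / 2 := by rw [hz]; ring
      rw [norm_twist_of_ne_zero _ (by rw [e]; positivity), e, Complex.norm_conj,
        ← Real.rpow_natCast, ← Real.rpow_mul (norm_nonneg _)]
      congr 1
      push_cast
      ring
    calc ‖Φ z‖ ≤ ∑ ω, ‖D (Fz z) (Gz z) ω‖ * ‖h z ω‖ :=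
          (norm_sum_le _ _).trans (le_of_eq (sum_congr rfl fun ω _ => norm_mul _ _))
      _ ≤ √(∑ ω, ‖D (Fz z) (Gz z) ω‖ ^ 2) * √(∑ ω, ‖h z ω‖ ^ 2) :=
          Real.sum_mul_le_sqrt_mul_sqrt _ _ _
      _ ≤ √(C * X) * √Y := by
          simp only [hsq]
          refine mul_le_mul_of_nonneg_right (Real.sqrt_le_sqrt ?_) (Real.sqrt_nonneg _)
          refine (bound_two _ _).trans (le_of_eq ?_)
          simp only [Fz, Gz, pow_four, hX]
  have value : Φ ((2 / p : ℝ) : ℂ) = Y := by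
    have tw (w : ℂ) : twist 0 (p / 2) w ((2 / p : ℝ) : ℂ) = w := by
      by_cases hw : w = 0
      · rw [hw, twist_zero]
      · have : (‖w‖ : ℂ) ≠ 0 := by simpa using hw
        rw [twist_of_add_eq (t := 1) w (by field_simp; ring) hw, Real.rpow_one,
          div_mul_cancel₀ _ this]
    have hF : Fz ((2 / p : ℝ) : ℂ) = F := funext fun i => tw _
    have hG : Gz ((2 / p : ℝ) : ℂ) = G := funext fun i => tw _
    simp only [Φ, hF, hG, hY, h]
    push_cast
    refine sum_congr rfl fun ω _ => ?_
    generalize D F G ω = w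
    by_cases hw : w = 0
    · simp [hw, Real.zero_rpow hp0.ne']
    · have hw1 : (‖w‖ : ℂ) ≠ 0 := by simpa using hw
      have hw2 : conj w ≠ 0 := by simpa using hw
      have := twist_of_add_eq (q := p) (r := -(p / 2)) (t := p - 1) (x := 2 / p) (conj w)
        (by field_simp; ring) hw2
      push_cast at this
      rw [this, Complex.norm_conj, ← mul_assoc, ← mul_div_assoc, Complex.mul_conj',
        Real.rpow_sub_one (norm_ne_zero_iff.2 hw)]
      push_cast
      field_simp
  have hpp : 2 / p ≤ 1 := (div_le_one hp0).2 hp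
  have main := norm_le_interp_of_mem_verticalClosedStrip₀₁' Φ (z := ((2 / p : ℝ) : ℂ))
    ⟨by rw [Complex.ofReal_re]; positivity, by rwa [Complex.ofReal_re]⟩
    hΦd.diffContOnCl hΦB left right
  rw [value, Complex.norm_real, Real.norm_of_nonneg hY0, Complex.ofReal_re] at main
  -- The three lines bound raised to the power `p` reads `Y ^ p ≤ B ^ (p - 2) * Y ^ (p - 2) * (C * X
  -- * Y)`; cancelling `Y ^ (p - 1)` needs `Y ≠ 0`.
  rcases hY0.eq_or_lt with h0 | h0
  · rw [← h0]
    positivity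
  have main' := Real.rpow_le_rpow hY0 main hp0.le
  rw [Real.mul_rpow (by positivity) (by positivity), ← Real.rpow_mul (by positivity),
    ← Real.rpow_mul (by positivity), show (1 - 2 / p) * p = p - 2 by field_simp,
    div_mul_cancel₀ _ hp0.ne', Real.rpow_two, mul_pow, Real.sq_sqrt (by positivity),
    Real.sq_sqrt hY0, Real.mul_rpow hB hY0] at main'
  have e1 : Y ^ p = Y * Y ^ (p - 1) := by
    rw [Real.rpow_sub_one h0.ne']
    field_simp
  have e2 : Y ^ (p - 2) * Y = Y ^ (p - 1) := by
    rw [show p - 2 = p - 1 - 1 by ring, Real.rpow_sub_one h0.ne' (p - 1)]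
    field_simp
  refine le_of_mul_le_mul_right ?_ (Real.rpow_pos_of_pos h0 (p - 1))
  rw [← e1, ← e2]
  linarith

end Interpolation

/-! ### The `L^p` estimate on a finite group -/

section FiniteGroup

variable {V : Type*} [AddCommGroup V] [Fintype V]

/-- The successive differences of the double averages over subgroups `H 0, …, H m`, as a bilinear
map. -/
def groupDifferences (H : ℕ → AddSubgroup V) (m : ℕ) :
    (V × V → ℂ) →ₗ[ℂ] (V × V → ℂ) →ₗ[ℂ] (Fin m × (V × V) → ℂ) :=
  LinearMap.mk₂ ℂ (fun F G ω => groupAverage (H ω.1) F G ω.2 - groupAverage (H (ω.1 + 1)) F G ω.2)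
    (fun F F' G => by
      ext ω
      simp only [groupAverage, Pi.add_apply, add_mul, expect_add_distrib]
      ring)
    (fun c F G => by
      ext ω
      simp only [groupAverage, Pi.smul_apply, smul_eq_mul, mul_assoc, ← mul_expect, mul_sub])
    (fun F G G' => by
      ext ω
      simp only [groupAverage, Pi.add_apply, mul_add, expect_add_distrib]
      ring)
    (fun c F G => by
      ext ω
      simp only [groupAverage, Pi.smul_apply, smul_eq_mul, mul_left_comm _ c, ← mul_expect,
        mul_sub])

theorem norm_groupAverage_le_one (H : AddSubgroup V) {F G : V × V → ℂ} (hF : ∀ z, ‖F z‖ ≤ 1)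
    (hG : ∀ z, ‖G z‖ ≤ 1) (z : V × V) : ‖groupAverage H F G z‖ ≤ 1 := by
  classical
  refine (RCLike.norm_expect_le (K := ℂ)).trans (expect_le univ_nonempty fun a _ => ?_)
  rw [norm_mul]
  exact mul_le_one₀ (hF _) (norm_nonneg _) (hG _)

theorem sum_norm_groupAverage_sub_rpow_le {H : ℕ → AddSubgroup V} (hH : Monotone H) {p : ℝ}
    (hp : 2 ≤ p) (F G : V × V → ℂ) (m : ℕ) :
    ∑ j ∈ range m, ∑ z, ‖groupAverage (H j) F G z - groupAverage (H (j + 1)) F G z‖ ^ p ≤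
      2 ^ (p - 2) * (3 / 2) * (∑ z, ‖F z‖ ^ (2 * p) + ∑ z, ‖G z‖ ^ (2 * p)) := by
  have := sum_norm_rpow_le_of_interpolation (groupDifferences H m) (B := 2) (C := 3 / 2)
    (by norm_num) (by norm_num) hp
    (fun F G hF hG ω => by
      refine (norm_sub_le _ _).trans ?_
      linarith [norm_groupAverage_le_one (H ω.1) hF hG ω.2,
        norm_groupAverage_le_one (H (ω.1 + 1)) hF hG ω.2])
    (fun F G => by
      refine le_trans (le_of_eq ?_) (sum_norm_groupAverage_sub_sq_le hH F G m)
      rw [Fintype.sum_prod_type, ← Fin.sum_univ_eq_sum_range fun j =>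
        ∑ z, ‖groupAverage (H j) F G z - groupAverage (H (j + 1)) F G z‖ ^ 2]
      rfl) F G
  rw [Fintype.sum_prod_type] at this
  rw [← Fin.sum_univ_eq_sum_range fun j =>
        ∑ z, ‖groupAverage (H j) F G z - groupAverage (H (j + 1)) F G z‖ ^ p]
  exact this

end FiniteGroup

/-! ### Transference to measure preserving actions -/

section Transference

variable {A X : Type*} [AddCommGroup A] [Finite A] [MeasurableSpace X] {μ : Measure X}
  {S T : Omega A → X → X} {f g : X → ℂ}

variable (A) in
/-- The subset `Φ_n` as a subgroup. -/
def folnerSubgroup (n : ℕ) : AddSubgroup (Omega A) where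
  carrier := folnerSet A n
  zero_mem' _ _ := rfl
  add_mem' ha hb k hk := by rw [Finsupp.add_apply, ha k hk, hb k hk, add_zero]
  neg_mem' ha k hk := by rw [Finsupp.neg_apply, ha k hk, neg_zero]

instance (n : ℕ) : Fintype (folnerSubgroup A n) := (folnerSet_finite A n).fintype

theorem mem_folnerSubgroup {n : ℕ} {a : Omega A} : a ∈ folnerSubgroup A n ↔ a ∈ folner A n :=
  (Set.Finite.mem_toFinset _).symm

omit [Finite A] in
theorem folnerSubgroup_mono : Monotone (folnerSubgroup A) :=
  fun _ _ h _ ha k hk => ha k (h.trans hk)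

omit [MeasurableSpace X] in
theorem doubleAverage_eq_expect (S T : Omega A → X → X) (f g : X → ℂ) (n : ℕ) (x : X) :
    doubleAverage S T f g n x = 𝔼 a ∈ folner A n, f (S a x) * g (T a x) := by
  rw [doubleAverage, expect_eq_sum_div_card, div_eq_inv_mul]

omit [Finite A] in
theorem IsMeasurePreservingAction.measurable (hS : IsMeasurePreservingAction μ S) (a : Omega A) :
    Measurable (S a) := (hS.measurePreserving a).measurable

theorem measurable_doubleAverage (hS : IsMeasurePreservingAction μ S)
    (hT : IsMeasurePreservingAction μ T) (hf : Measurable f) (hg : Measurable g) (n : ℕ) :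
    Measurable (doubleAverage S T f g n) :=
  measurable_const.mul <| Finset.measurable_fun_sum _ fun a _ =>
    (hf.comp (hS.measurable a)).mul (hg.comp (hT.measurable a))

/-- Along the orbit of `x`, the double averages are the double averages over the subgroup `Φ_n` of
the finite group `Φ_N`. -/
theorem groupAverage_orbit (hS : IsMeasurePreservingAction μ S)
    (hT : IsMeasurePreservingAction μ T) (hST : ∀ a b, S a ∘ T b = T b ∘ S a) (f g : X → ℂ)
    {n N : ℕ} (h : n ≤ N) (x : X) (z : folnerSubgroup A N × folnerSubgroup A N) :
    groupAverage ((folnerSubgroup A n).addSubgroupOf (folnerSubgroup A N))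
      (fun z => f (S z.1 (T z.2 x))) (fun z => g (S z.1 (T z.2 x))) z =
      doubleAverage S T f g n (S z.1 (T z.2 x)) := by
  classical
  rw [doubleAverage_eq_expect, groupAverage]
  refine expect_bij (fun a _ => ((a : folnerSubgroup A N) : Omega A))
    (fun a _ => mem_folnerSubgroup.1 (AddSubgroup.mem_addSubgroupOf.1 a.2)) (fun a _ => ?_)
    (fun a _ b _ hab => Subtype.ext (Subtype.ext hab)) (fun b hb => ?_)
  · have h1 : S (z.1 + a : folnerSubgroup A N) (T z.2 x) = S a (S z.1 (T z.2 x)) := by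
      rw [AddSubgroup.coe_add, add_comm, hS.map_add]
      rfl
    have h2 : S z.1 (T (z.2 + a : folnerSubgroup A N) x) = T a (S z.1 (T z.2 x)) := by
      rw [AddSubgroup.coe_add, add_comm, hT.map_add]
      exact congrFun (hST z.1 a) (T z.2 x)
    simp only [h1, h2]
  · have hb' := mem_folnerSubgroup.2 hb
    exact ⟨⟨⟨b, folnerSubgroup_mono h hb'⟩, AddSubgroup.mem_addSubgroupOf.2 hb'⟩,
      mem_univ _, rfl⟩

omit [Finite A] in
theorem lintegral_orbit (hS : IsMeasurePreservingAction μ S) (hT : IsMeasurePreservingAction μ T)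
    {φ : X → ℝ≥0∞} (hφ : Measurable φ) (a b : Omega A) :
    ∫⁻ x, φ (S a (T b x)) ∂μ = ∫⁻ x, φ x ∂μ :=
  ((hT.measurePreserving b).lintegral_comp (hφ.comp (hS.measurable a))).trans
    ((hS.measurePreserving a).lintegral_comp hφ)

theorem enorm_rpow_eq_ofReal {p : ℝ} (hp : 0 ≤ p) (w : ℂ) :
    ‖w‖ₑ ^ p = ENNReal.ofReal (‖w‖ ^ p) := by
  rw [← ofReal_norm, ENNReal.ofReal_rpow_of_nonneg (norm_nonneg _) hp]

/-- The finite estimate holds on the orbit of every point `x`. Integrating in `x`, each of the `|V ×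
V|` orbit terms contributes the same integral by invariance, and this factor cancels. -/
theorem sum_lintegral_doubleAverage_sub_le (hS : IsMeasurePreservingAction μ S)
    (hT : IsMeasurePreservingAction μ T) (hST : ∀ a b, S a ∘ T b = T b ∘ S a)
    (hf : Measurable f) (hg : Measurable g) {p : ℝ} (hp : 2 ≤ p) {n : ℕ → ℕ} (hn : Monotone n)
    (m : ℕ) :
    ∑ j ∈ range m, ∫⁻ x, ‖doubleAverage S T f g (n j) x - doubleAverage S T f g (n (j + 1)) x‖ₑ ^ p
        ∂μ ≤ ENNReal.ofReal (2 ^ (p - 2) * (3 / 2)) *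
      (∫⁻ x, ‖f x‖ₑ ^ (2 * p) ∂μ + ∫⁻ x, ‖g x‖ₑ ^ (2 * p) ∂μ) := by
  classical
  have hp0 : 0 ≤ p := by linarith
  set N := n m
  let V := folnerSubgroup A N
  -- Truncation at `m` makes the chain stop at `V` itself, so it is monotone on all of `ℕ` without
  -- changing the differences with `j < m`.
  let H : ℕ → AddSubgroup V := fun j => (folnerSubgroup A (n (min j m))).addSubgroupOf V
  have hH : Monotone H := fun i j hij =>
    AddSubgroup.comap_mono (folnerSubgroup_mono (hn (min_le_min_right m hij)))
  let d : ℕ → X → ℂ := fun j x => doubleAverage S T f g (n j) x - doubleAverage S T f g (n (j + 1)) x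
  have hd (j : ℕ) : Measurable fun x => ‖d j x‖ₑ ^ p :=
    (((measurable_doubleAverage hS hT hf hg _).sub
      (measurable_doubleAverage hS hT hf hg _)).enorm).pow_const p
  have hf' : Measurable fun x => ‖f x‖ₑ ^ (2 * p) := hf.enorm.pow_const _
  have hg' : Measurable fun x => ‖g x‖ₑ ^ (2 * p) := hg.enorm.pow_const _
  have orbit {φ : X → ℝ≥0∞} (hφ : Measurable φ) (z : V × V) :
      Measurable fun x => φ (S z.1 (T z.2 x)) :=
    hφ.comp ((hS.measurable _).comp (hT.measurable _))
  have pointwise (x : X) : ∑ j ∈ range m, ∑ z : V × V, ‖d j (S z.1 (T z.2 x))‖ₑ ^ p ≤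
      ENNReal.ofReal (2 ^ (p - 2) * (3 / 2)) * (∑ z : V × V, ‖f (S z.1 (T z.2 x))‖ₑ ^ (2 * p) +
        ∑ z : V × V, ‖g (S z.1 (T z.2 x))‖ₑ ^ (2 * p)) := by
    have key := sum_norm_groupAverage_sub_rpow_le hH hp (fun z => f (S z.1 (T z.2 x)))
      (fun z => g (S z.1 (T z.2 x))) m
    have h2p : 0 ≤ 2 * p := by linarith
    simp only [enorm_rpow_eq_ofReal hp0, enorm_rpow_eq_ofReal h2p]
    have pos (r : ℝ) (w : ℂ) : 0 ≤ ‖w‖ ^ r := by positivity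
    simp only [← ENNReal.ofReal_sum_of_nonneg fun _ _ => pos _ _]
    rw [← ENNReal.ofReal_sum_of_nonneg fun _ _ => sum_nonneg fun _ _ => pos _ _,
      ← ENNReal.ofReal_add (sum_nonneg fun _ _ => pos _ _) (sum_nonneg fun _ _ => pos _ _),
      ← ENNReal.ofReal_mul (by positivity)]
    refine ENNReal.ofReal_le_ofReal (le_trans (le_of_eq ?_) key)
    refine sum_congr rfl fun j hj => sum_congr rfl fun z _ => ?_
    have hj := mem_range.1 hj
    simp only [H]
    rw [min_eq_left hj.le, min_eq_left (Nat.succ_le_of_lt hj),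
      groupAverage_orbit hS hT hST f g (hn hj.le), groupAverage_orbit hS hT hST f g (hn hj)]
  have hsf := Finset.measurable_fun_sum univ fun z (_ : z ∈ (univ : Finset (V × V))) => orbit hf' z
  have hsg := Finset.measurable_fun_sum univ fun z (_ : z ∈ (univ : Finset (V × V))) => orbit hg' z
  have hsum : Measurable fun x => ∑ z : V × V, ‖f (S z.1 (T z.2 x))‖ₑ ^ (2 * p) +
      ∑ z : V × V, ‖g (S z.1 (T z.2 x))‖ₑ ^ (2 * p) := hsf.add hsg
  have integrated := lintegral_mono (μ := μ) pointwise
  rw [lintegral_finsetSum _ fun j _ => Finset.measurable_fun_sum _ fun z _ => orbit (hd j) z,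
    lintegral_const_mul _ hsum, lintegral_add_left hsf,
    lintegral_finsetSum _ fun z _ => orbit hf' z, lintegral_finsetSum _ fun z _ => orbit hg' z]
    at integrated
  simp only [lintegral_finsetSum _ fun z _ => orbit (hd _) z, lintegral_orbit hS hT (hd _),
    lintegral_orbit hS hT hf', lintegral_orbit hS hT hg', sum_const,
    nsmul_eq_mul] at integrated
  rw [← mul_sum, ← mul_add, mul_left_comm] at integrated
  exact (ENNReal.mul_le_mul_iff_right (by simp) (ENNReal.natCast_ne_top _)).1 integrated

end Transference

/-! ### Norm variation -/

section Variation

variable {A X : Type*} [AddCommGroup A] [Finite A] [MeasurableSpace X] {μ : Measure X}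
  {S T : Omega A → X → X} {f g : X → ℂ}

theorem eLpNorm_ofReal_rpow {p : ℝ} (hp : 0 < p) (f : X → ℂ) :
    eLpNorm f (ENNReal.ofReal p) μ ^ p = ∫⁻ x, ‖f x‖ₑ ^ p ∂μ := by
  have := eLpNorm_nnreal_pow_eq_lintegral (μ := μ) (f := f) (Real.toNNReal_pos.2 hp).ne'
  rwa [Real.coe_toNNReal p hp.le] at this

omit [MeasurableSpace X] in
theorem doubleAverage_smul (S T : Omega A → X → X) (c d : ℂ) (f g : X → ℂ) (n : ℕ) :
    doubleAverage S T (c • f) (d • g) n = (c * d) • doubleAverage S T f g n := by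
  funext x
  simp only [doubleAverage, Pi.smul_apply, smul_eq_mul, mul_sum]
  refine sum_congr rfl fun a _ => ?_
  ring

theorem doubleAverage_ae_eq_zero_left (hS : IsMeasurePreservingAction μ S) (hf : f =ᵐ[μ] 0)
    (n : ℕ) : doubleAverage S T f g n =ᵐ[μ] 0 := by
  have : ∀ᵐ x ∂μ, ∀ a ∈ folner A n, f (S a x) = 0 :=
    (Finset.eventually_all _).2 fun a _ => (hS.measurePreserving a).quasiMeasurePreserving.ae hf
  filter_upwards [this] with x hx
  rw [doubleAverage, sum_eq_zero fun a ha => by rw [hx a ha, zero_mul], mul_zero, Pi.zero_apply]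

theorem doubleAverage_ae_eq_zero_right (hT : IsMeasurePreservingAction μ T) (hg : g =ᵐ[μ] 0)
    (n : ℕ) : doubleAverage S T f g n =ᵐ[μ] 0 := by
  have : ∀ᵐ x ∂μ, ∀ a ∈ folner A n, g (T a x) = 0 :=
    (Finset.eventually_all _).2 fun a _ => (hT.measurePreserving a).quasiMeasurePreserving.ae hg
  filter_upwards [this] with x hx
  rw [doubleAverage, sum_eq_zero fun a ha => by rw [hx a ha, mul_zero], mul_zero, Pi.zero_apply]

/-- The constant in the norm-variation estimate. -/
def variationConst (p : ℝ) : ℝ≥0 := 2 * (2 ^ (p - 2) * (3 / 2) : ℝ).toNNReal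

theorem variationConst_ne_zero (p : ℝ) : variationConst p ≠ 0 :=
  mul_ne_zero two_ne_zero (Real.toNNReal_pos.2 (by positivity)).ne'

theorem sum_eLpNorm_doubleAverage_sub_le (hS : IsMeasurePreservingAction μ S)
    (hT : IsMeasurePreservingAction μ T) (hST : ∀ a b, S a ∘ T b = T b ∘ S a)
    (hf : Measurable f) (hg : Measurable g) {p : ℝ} (hp : 2 ≤ p) {n : ℕ → ℕ} (hn : Monotone n)
    (m : ℕ) :
    ∑ j ∈ range m, eLpNorm (doubleAverage S T f g (n j) - doubleAverage S T f g (n (j + 1)))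
        (ENNReal.ofReal p) μ ^ p ≤
      variationConst p * eLpNorm f (ENNReal.ofReal (2 * p)) μ ^ p *
        eLpNorm g (ENNReal.ofReal (2 * p)) μ ^ p := by
  have hp0 : 0 < p := by linarith
  have h2p : ENNReal.ofReal (2 * p) ≠ 0 := by simpa using hp0
  have zero (h : ∀ n, doubleAverage S T f g n =ᵐ[μ] 0) :
      ∑ j ∈ range m, eLpNorm (doubleAverage S T f g (n j) - doubleAverage S T f g (n (j + 1)))
        (ENNReal.ofReal p) μ ^ p = 0 := by
    refine sum_eq_zero fun j _ => ?_
    rw [eLpNorm_congr_ae ((h (n j)).sub (h (n (j + 1)))), sub_zero, eLpNorm_zero,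
      ENNReal.zero_rpow_of_pos hp0]
  -- A vanishing norm must be treated before an infinite one: the bound is then `0` even if the
  -- other norm is infinite, and so are all averages almost everywhere.
  by_cases hf0 : eLpNorm f (ENNReal.ofReal (2 * p)) μ = 0
  · rw [zero (doubleAverage_ae_eq_zero_left hS
      ((eLpNorm_eq_zero_iff hf.aestronglyMeasurable h2p).1 hf0))]
    exact zero_le
  by_cases hg0 : eLpNorm g (ENNReal.ofReal (2 * p)) μ = 0
  · rw [zero (doubleAverage_ae_eq_zero_right hT
      ((eLpNorm_eq_zero_iff hg.aestronglyMeasurable h2p).1 hg0))]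
    exact zero_le
  have hC : (variationConst p : ℝ≥0∞) ≠ 0 := by simpa using variationConst_ne_zero p
  by_cases hft : eLpNorm f (ENNReal.ofReal (2 * p)) μ = ⊤
  · rw [hft, ENNReal.top_rpow_of_pos hp0, ENNReal.mul_top hC, ENNReal.top_mul]
    · exact le_top
    · exact fun h => hg0 ((ENNReal.rpow_eq_zero_iff_of_pos hp0).1 h)
  by_cases hgt : eLpNorm g (ENNReal.ofReal (2 * p)) μ = ⊤
  · rw [hgt, ENNReal.top_rpow_of_pos hp0, ENNReal.mul_top]
    · exact le_top
    · exact mul_ne_zero hC fun h => hf0 ((ENNReal.rpow_eq_zero_iff_of_pos hp0).1 h)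
  -- The estimate so far bounds by a sum of `2p`-th powers of norms. Applied to functions of norm
  -- one and rescaled by bilinearity, it gives the product.
  have normalise {f : X → ℂ} (h0 : eLpNorm f (ENNReal.ofReal (2 * p)) μ ≠ 0)
      (ht : eLpNorm f (ENNReal.ofReal (2 * p)) μ ≠ ⊤) : ∃ (c : ℂ) (f' : X → ℂ), f = c • f' ∧
        (Measurable f → Measurable f') ∧ ‖c‖ₑ = eLpNorm f (ENNReal.ofReal (2 * p)) μ ∧
        ∫⁻ x, ‖f' x‖ₑ ^ (2 * p) ∂μ = 1 := by
    set r := eLpNorm f (ENNReal.ofReal (2 * p)) μ with hr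
    have hr0 : r.toReal ≠ 0 := (ENNReal.toReal_pos h0 ht).ne'
    have hc : (r.toReal : ℂ) ≠ 0 := Complex.ofReal_ne_zero.2 hr0
    have hcr : ‖(r.toReal : ℂ)‖ₑ = r := by
      rw [← ofReal_norm, Complex.norm_real, Real.norm_of_nonneg ENNReal.toReal_nonneg,
        ENNReal.ofReal_toReal ht]
    refine ⟨r.toReal, (r.toReal : ℂ)⁻¹ • f, ?_, fun h => h.const_smul _, hcr, ?_⟩
    · rw [smul_smul, mul_inv_cancel₀ hc, one_smul]
    · rw [← eLpNorm_ofReal_rpow (by linarith), eLpNorm_const_smul, enorm_inv hc, hcr, ← hr,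
        ENNReal.inv_mul_cancel h0 ht, ENNReal.one_rpow]
  obtain ⟨c, f', hcf, hf', hc, hcn⟩ := normalise hf0 hft
  obtain ⟨d, g', hdg, hg', hd, hdn⟩ := normalise hg0 hgt
  have main := sum_lintegral_doubleAverage_sub_le hS hT hST (hf' hf) (hg' hg) hp hn m
  -- The sum is now `1 + 1`, the origin of the factor `2` in `variationConst`.
  rw [hcn, hdn] at main
  rw [← hc, ← hd, hcf, hdg]
  have scale (j : ℕ) : eLpNorm (doubleAverage S T (c • f') (d • g') (n j) -
      doubleAverage S T (c • f') (d • g') (n (j + 1))) (ENNReal.ofReal p) μ ^ p =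
      ‖c‖ₑ ^ p * ‖d‖ₑ ^ p * ∫⁻ x, ‖doubleAverage S T f' g' (n j) x -
        doubleAverage S T f' g' (n (j + 1)) x‖ₑ ^ p ∂μ := by
    rw [doubleAverage_smul, doubleAverage_smul, ← smul_sub, eLpNorm_const_smul,
      ENNReal.mul_rpow_of_nonneg _ _ hp0.le, eLpNorm_ofReal_rpow hp0, enorm_mul,
      ENNReal.mul_rpow_of_nonneg _ _ hp0.le]
    rfl
  rw [sum_congr rfl fun j _ => scale j, ← mul_sum]
  refine (mul_le_mul_right main _).trans (le_of_eq ?_)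
  rw [variationConst, ENNReal.coe_mul, ENNReal.coe_ofNat, ENNReal.ofReal]
  ring

theorem normVariation_doubleAverage_le (hS : IsMeasurePreservingAction μ S)
    (hT : IsMeasurePreservingAction μ T) (hST : ∀ a b, S a ∘ T b = T b ∘ S a)
    (hf : Measurable f) (hg : Measurable g) {p : ℝ} (hp : 2 ≤ p) :
    normVariation μ p (doubleAverage S T f g) ≤
      variationConst p * eLpNorm f (ENNReal.ofReal (2 * p)) μ ^ p *
        eLpNorm g (ENNReal.ofReal (2 * p)) μ ^ p := by
  refine iSup_le fun m => iSup_le fun n => iSup_le fun hn => ?_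
  -- Extended by its last value, the finite sequence becomes a monotone sequence on `ℕ`.
  let k : ℕ → ℕ := fun i => n ⟨min i m, Nat.lt_succ_of_le (min_le_right i m)⟩
  have hk : Monotone k := fun i j hij => hn.monotone (Fin.mk_le_mk.2 (min_le_min_right m hij))
  refine le_trans (le_of_eq ?_) (sum_eLpNorm_doubleAverage_sub_le hS hT hST hf hg hp hk m)
  rw [← Fin.sum_univ_eq_sum_range fun j => eLpNorm (doubleAverage S T f g (k j) -
    doubleAverage S T f g (k (j + 1))) (ENNReal.ofReal p) μ ^ p]
  refine sum_congr rfl fun j _ => ?_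
  have h1 : k j = n j.castSucc := congrArg n (Fin.ext (min_eq_left j.2.le))
  have h2 : k (j + 1) = n j.succ := congrArg n (Fin.ext (min_eq_left j.2))
  rw [h1, h2]

/-! ### Jump counting and convergence -/

theorem sum_range_even_le (t : ℕ → ℝ≥0∞) (m : ℕ) :
    ∑ j ∈ range m, t (2 * j) ≤ ∑ i ∈ range (2 * m), t i := by
  induction m with
  | zero => simp
  | succ m ih =>
    rw [sum_range_succ, mul_add, mul_one, sum_range_succ, sum_range_succ]
    exact le_add_right (by gcongr)

/-- Lists `n_1, n'_1, n_2, n'_2, …` as one sequence, constant after its last term. It need not be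
strictly increasing since `n'_j = n_{j+1}` is allowed, which is why the variation estimate is stated
for monotone sequences. -/
theorem exists_monotone_interleaving {m : ℕ} {n n' : Fin m → ℕ} (h : ∀ j, n j < n' j)
    (h' : ∀ i j, i < j → n' i ≤ n j) :
    ∃ k : ℕ → ℕ, Monotone k ∧ ∀ j : Fin m, k (2 * j) = n j ∧ k (2 * j + 1) = n' j := by
  rcases m with _ | m
  · exact ⟨fun _ => 0, monotone_const, fun j => j.elim0⟩
  let t : ℕ → Fin (m + 1) := fun i => ⟨min (i / 2) m, by omega⟩
  refine ⟨fun i => if i % 2 = 0 ∧ i / 2 ≤ m then n (t i) else n' (t i),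
    monotone_nat_of_le_succ fun i => ?_, fun j => ⟨?_, ?_⟩⟩
  · have eq_of (a b : ℕ) (hab : min (a / 2) m = min (b / 2) m) : t a = t b := Fin.ext hab
    split_ifs with h1 h2 h2
    · omega
    · rw [eq_of i (i + 1) (by omega)]
      exact (h _).le
    · exact h' _ _ (Fin.mk_lt_mk.2 (by omega))
    · rw [eq_of i (i + 1) (by omega)]
  · have hj : t (2 * j) = j := Fin.ext (show min (2 * (j : ℕ) / 2) m = j by omega)
    dsimp only
    rw [if_pos (by omega), hj]
  · have hj : t (2 * j + 1) = j := Fin.ext (show min ((2 * (j : ℕ) + 1) / 2) m = j by omega)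
    dsimp only
    rw [if_neg (by omega), hj]

theorem HasJumps.mul_rpow_le (hS : IsMeasurePreservingAction μ S)
    (hT : IsMeasurePreservingAction μ T) (hST : ∀ a b, S a ∘ T b = T b ∘ S a)
    (hf : Measurable f) (hg : Measurable g) {p : ℝ} (hp : 2 ≤ p) {ε : ℝ} {m : ℕ}
    (hm : HasJumps μ p (doubleAverage S T f g) ε m) :
    m * ENNReal.ofReal ε ^ p ≤
      variationConst p * eLpNorm f (ENNReal.ofReal (2 * p)) μ ^ p *
        eLpNorm g (ENNReal.ofReal (2 * p)) μ ^ p := by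
  obtain ⟨n, n', h, h', hε⟩ := hm
  obtain ⟨k, hk, hkn⟩ := exists_monotone_interleaving h h'
  refine le_trans ?_ (sum_eLpNorm_doubleAverage_sub_le hS hT hST hf hg hp hk (2 * m))
  refine le_trans ?_ (sum_range_even_le _ m)
  rw [← Fin.sum_univ_eq_sum_range fun j => eLpNorm (doubleAverage S T f g (k (2 * j)) -
    doubleAverage S T f g (k (2 * j + 1))) (ENNReal.ofReal p) μ ^ p]
  calc _ = ∑ _j : Fin m, ENNReal.ofReal ε ^ p := by simp
    _ ≤ _ := sum_le_sum fun j _ => by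
      rw [(hkn j).1, (hkn j).2]
      exact ENNReal.rpow_le_rpow (hε j) (by linarith)

theorem numJumps_doubleAverage_le (hS : IsMeasurePreservingAction μ S)
    (hT : IsMeasurePreservingAction μ T) (hST : ∀ a b, S a ∘ T b = T b ∘ S a)
    (hf : Measurable f) (hg : Measurable g) {p : ℝ} (hp : 2 ≤ p) {ε : ℝ} (hε : 0 < ε) :
    (numJumps μ p (doubleAverage S T f g) ε : ℝ≥0∞) ≤
      variationConst p * ENNReal.ofReal (ε ^ (-p)) * eLpNorm f (ENNReal.ofReal (2 * p)) μ ^ p *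
        eLpNorm g (ENNReal.ofReal (2 * p)) μ ^ p := by
  simp only [numJumps, ENat.toENNReal_iSup, ENat.toENNReal_coe]
  refine iSup₂_le fun m hm => ?_
  have key := HasJumps.mul_rpow_le hS hT hST hf hg hp hm
  have cancel : ENNReal.ofReal ε ^ p * ENNReal.ofReal (ε ^ (-p)) = 1 := by
    rw [ENNReal.ofReal_rpow_of_pos hε, ← ENNReal.ofReal_mul (by positivity), ← Real.rpow_add hε,
      add_neg_cancel, Real.rpow_zero, ENNReal.ofReal_one]
  calc (m : ℝ≥0∞) = m * ENNReal.ofReal ε ^ p * ENNReal.ofReal (ε ^ (-p)) := by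
        rw [mul_assoc, cancel, mul_one]
    _ ≤ _ := mul_le_mul_left key _
    _ = _ := by ring

/-- Greedy choice: each new jump is sought beyond the end of the previous one. -/
theorem hasJumps_of_frequently {p ε : ℝ} {M : ℕ → X → ℂ}
    (h : ∀ N, ∃ n n', N ≤ n ∧ n < n' ∧
      ENNReal.ofReal ε ≤ eLpNorm (M n - M n') (ENNReal.ofReal p) μ) (m : ℕ) :
    HasJumps μ p M ε m := by
  choose a a' h1 h2 h3 using h
  let N : ℕ → ℕ := fun j => a'^[j] 0
  have succ (j : ℕ) : N (j + 1) = a' (N j) := Function.iterate_succ_apply' a' j 0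
  have mono : Monotone N :=
    monotone_nat_of_le_succ fun j => by rw [succ]; exact (h1 _).trans (h2 _).le
  refine ⟨fun j => a (N j), fun j => a' (N j), fun j => h2 _, fun i j hij => ?_, fun j => h3 _⟩
  dsimp only
  rw [← succ]
  exact (mono (Nat.succ_le_of_lt hij)).trans (h1 _)

theorem memLp_doubleAverage (hS : IsMeasurePreservingAction μ S)
    (hT : IsMeasurePreservingAction μ T) {p : ℝ} (hp : 0 < p)
    (hf : MemLp f (ENNReal.ofReal (2 * p)) μ) (hg : MemLp g (ENNReal.ofReal (2 * p)) μ) (n : ℕ) :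
    MemLp (doubleAverage S T f g n) (ENNReal.ofReal p) μ := by
  have : ENNReal.HolderTriple (ENNReal.ofReal (2 * p)) (ENNReal.ofReal (2 * p))
      (ENNReal.ofReal p) := ⟨by
    rw [← ENNReal.ofReal_inv_of_pos hp, ← ENNReal.ofReal_inv_of_pos (by positivity),
      ← ENNReal.ofReal_add (by positivity) (by positivity)]
    congr 1
    field_simp
    norm_num⟩
  have summand (a : Omega A) : MemLp (fun x => f (S a x) * g (T a x)) (ENNReal.ofReal p) μ :=
    (hg.comp_measurePreserving (hT.measurePreserving a)).mul'
      (hf.comp_measurePreserving (hS.measurePreserving a))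
  exact (memLp_finsetSum (folner A n) fun a _ => summand a).const_mul _

/-- A sequence that is not Cauchy in `L^p` has, for some `ε`, arbitrarily many `ε`-jumps, against
the finite bound on `m * ε ^ p`. Completeness of `L^p` supplies the limit. -/
theorem exists_tendsto_doubleAverage (hS : IsMeasurePreservingAction μ S)
    (hT : IsMeasurePreservingAction μ T) (hST : ∀ a b, S a ∘ T b = T b ∘ S a)
    (hf : Measurable f) (hg : Measurable g) {p : ℝ} (hp : 2 ≤ p)
    (hfp : MemLp f (ENNReal.ofReal (2 * p)) μ) (hgp : MemLp g (ENNReal.ofReal (2 * p)) μ) :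
    ∃ h : X → ℂ, MemLp h (ENNReal.ofReal p) μ ∧
      Tendsto (fun n => eLpNorm (doubleAverage S T f g n - h) (ENNReal.ofReal p) μ) atTop
        (𝓝 0) := by
  have hp0 : 0 < p := by linarith
  have : Fact (1 ≤ ENNReal.ofReal p) := ⟨ENNReal.one_le_ofReal.2 (by linarith)⟩
  have hM := memLp_doubleAverage hS hT hp0 hfp hgp
  let u : ℕ → Lp ℂ (ENNReal.ofReal p) μ := fun n => (hM n).toLp
  have cauchy : CauchySeq u := by
    rw [Metric.cauchySeq_iff]
    by_contra! hnot
    obtain ⟨ε, hε, hnot⟩ := hnot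
    have jumps := hasJumps_of_frequently (μ := μ) (p := p) (ε := ε) (M := doubleAverage S T f g)
      fun N => by
        have large (i j : ℕ) (hij : ε ≤ dist (u i) (u j)) : ENNReal.ofReal ε ≤
            eLpNorm (doubleAverage S T f g i - doubleAverage S T f g j) (ENNReal.ofReal p) μ := by
          rw [← Lp.edist_toLp_toLp _ _ (hM i) (hM j), edist_dist]
          exact ENNReal.ofReal_le_ofReal hij
        obtain ⟨i, hi, j, hj, hij⟩ := hnot N
        rcases lt_trichotomy i j with h | rfl | h
        · exact ⟨i, j, hi, h, large i j hij⟩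
        · rw [dist_self] at hij
          exact absurd hij hε.not_ge
        · exact ⟨j, i, hj, h, large j i (by rwa [dist_comm])⟩
    set R := (variationConst p : ℝ≥0∞) * eLpNorm f (ENNReal.ofReal (2 * p)) μ ^ p *
        eLpNorm g (ENNReal.ofReal (2 * p)) μ ^ p with hR
    have hRt : R ≠ ⊤ := ENNReal.mul_ne_top (ENNReal.mul_ne_top ENNReal.coe_ne_top
      (ENNReal.rpow_ne_top_of_nonneg hp0.le hfp.2.ne)) (ENNReal.rpow_ne_top_of_nonneg hp0.le hgp.2.ne)
    have hε0 : ENNReal.ofReal ε ^ p ≠ 0 := (ENNReal.rpow_pos (by simpa) (by simp)).ne'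
    obtain ⟨m, hm⟩ := ENNReal.exists_nat_mul_gt hε0 hRt
    exact hm.not_ge (HasJumps.mul_rpow_le hS hT hST hf hg hp (jumps m))
  obtain ⟨h, hh⟩ := cauchySeq_tendsto_of_complete cauchy
  refine ⟨h, Lp.memLp h, ?_⟩
  rw [← Lp.toLp_coeFn h (Lp.memLp h)] at hh
  exact (Lp.tendsto_Lp_iff_tendsto_eLpNorm'' _ hM _ _).1 hh

end Variation

end DoubleAverages

end

theorem theorem1 (p : ℝ) (hp : 2 ≤ p) :
    ∃ C : ℝ≥0,
      ∀ (A : Type*) [AddCommGroup A] [Finite A]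
        (X : Type*) [MeasurableSpace X] [StandardBorelSpace X]
        (μ : Measure X) [IsProbabilityMeasure μ]
        (S T : DoubleAverages.Omega A → X → X)
        (_hS : DoubleAverages.IsMeasurePreservingAction μ S)
        (_hT : DoubleAverages.IsMeasurePreservingAction μ T)
        (_hST : ∀ a b, S a ∘ T b = T b ∘ S a)
        (f g : X → ℂ) (_hf : Measurable f) (_hg : Measurable g),
        DoubleAverages.normVariation μ p (DoubleAverages.doubleAverage S T f g) ≤
            C * eLpNorm f (ENNReal.ofReal (2 * p)) μ ^ p *
              eLpNorm g (ENNReal.ofReal (2 * p)) μ ^ p ∧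
        (∀ ε : ℝ, 0 < ε →
          (DoubleAverages.numJumps μ p (DoubleAverages.doubleAverage S T f g) ε : ℝ≥0∞) ≤
            C * ENNReal.ofReal (ε ^ (-p)) * eLpNorm f (ENNReal.ofReal (2 * p)) μ ^ p *
              eLpNorm g (ENNReal.ofReal (2 * p)) μ ^ p) ∧
        (MemLp f (ENNReal.ofReal (2 * p)) μ → MemLp g (ENNReal.ofReal (2 * p)) μ →
          (∀ n, MemLp (DoubleAverages.doubleAverage S T f g n) (ENNReal.ofReal p) μ) ∧
          ∃ h : X → ℂ, MemLp h (ENNReal.ofReal p) μ ∧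
            Tendsto (fun n => eLpNorm (DoubleAverages.doubleAverage S T f g n - h)
              (ENNReal.ofReal p) μ) atTop (𝓝 0)) := by

  refine ⟨DoubleAverages.variationConst p, ?_⟩
  intro A _ _ X _ _ μ _ S T hS hT hST f g hf hg
  exact ⟨DoubleAverages.normVariation_doubleAverage_le hS hT hST hf hg hp,
    fun ε hε => DoubleAverages.numJumps_doubleAverage_le hS hT hST hf hg hp hε,
    fun hfp hgp => ⟨DoubleAverages.memLp_doubleAverage hS hT (by linarith) hfp hgp,
      DoubleAverages.exists_tendsto_doubleAverage hS hT hST hf hg hp hfp hgp⟩⟩
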